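/- Let $c\in\mathbb R\setminus\{0\}$, let $\varphi(x)=(x^2+c^2)^{1/2}$ for $x\in\mathbb R$ be the univariate multiquadric, and let $$\hat\varphi(\xi)=-\frac{2|c|}{|\xi|}\,K_1(|c||\xi|),\qquad \xi\in\mathbb R\setminus\{0\},$$ where $K_1$ is the modified Bessel function of the second kind, $K_1(z)=\int_0^\infty e^{-z\cosh t}\cosh t\,dt$ for $z>0$. Then: (i) $\hat\varphi$ is the distributional Fourier transform of $\varphi$ on $\mathbb R\setminus\{0\}$: for every Schwartz function $g:\mathbb R\to\mathbb C$ that vanishes in a neighbourhood of $0$, with $\hat g(x)=\int_{\mathbb R} g(\xi)e^{-ix\xi}\,d\xi$, we have $$\int_{\mathbb R}\varphi(x)\,\hat g(x)\,dx=\int_{\mathbb R}\hat\varphi(\xi)\,g(\xi)\,d\xi,$$ and both integrals converge absolutely. (ii) For every $\eta\in(0,2\pi)$ the series defining the symbol function $\sigma(\eta)=\sum_{k\in\mathbb Z}\hat\varphi(\eta+2\pi k)$ converges absolutely, and there are nonzero, finitely supported complex sequences $y^{(n)}=(y^{(n)}_j)_{j\in\mathbb Z}$, $n\in\mathbb N$,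 with $\sum_{j} y^{(n)}_j=0$ for every $n$, such that $$\lim_{n\to\infty}\ \frac{\sum_{j,k\in\mathbb Z} y^{(n)}_j\,\overline{y^{(n)}_k}\,\varphi(j-k)}{\sum_{j\in\mathbb Z}|y^{(n)}_j|^2}=\sigma(\eta).$$ -/

import Mathlib

noncomputable section

namespace Multiquadric

/-- The univariate multiquadric `φ(x) = (x² + c²)^{1/2}`. -/
def phi (c x : ℝ) : ℝ := Real.sqrt (x ^ 2 + c ^ 2)

/-- The modified Bessel function of the second kind `K_ν(z)`, for real order `ν` and `z > 0`
(only positive arguments are used), by its standard integral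
`K_ν(z) = ∫₀^∞ exp(-z cosh t) cosh(ν t) dt`. -/
def besselK (ν z : ℝ) : ℝ :=
  ∫ t in Set.Ioi (0 : ℝ), Real.exp (-z * Real.cosh t) * Real.cosh (ν * t)

/-- The function `ξ ↦ -(2c/|ξ|) K₁(c|ξ|)` on `ξ ≠ 0`. As `phi c` depends on `c²` only,
`c` is replaced by `|c|`, which also covers negative `c`. The value at `ξ = 0` is irrelevant. -/
def phiHat (c ξ : ℝ) : ℝ := -(2 * |c| / |ξ|) * besselK 1 (|c| * |ξ|)

/-- The function `F` on `ℝ ∖ {0}` is the distributional Fourier transform, away from the origin,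
of the function `f`, with the convention `f̂(ξ) = ∫ f(x) e^{-ixξ} dx`: for every Schwartz function
`g` that vanishes near the origin, `∫ f(x) ĝ(x) dx = ∫ F(ξ) g(ξ) dξ`, both integrals being
absolutely convergent. -/
def IsGeneralizedFourierTransform (f F : ℝ → ℝ) : Prop :=
  ∀ g : SchwartzMap ℝ ℂ, (0 : ℝ) ∉ tsupport (fun ξ => g ξ) →
    MeasureTheory.Integrable
      (fun x : ℝ => (f x : ℂ) * ∫ ξ : ℝ, g ξ * Complex.exp (-Complex.I * x * ξ)) ∧
    MeasureTheory.Integrable (fun ξ : ℝ => (F ξ : ℂ) * g ξ) ∧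
    ∫ x : ℝ, (f x : ℂ) * ∫ ξ : ℝ, g ξ * Complex.exp (-Complex.I * x * ξ) =
      ∫ ξ : ℝ, (F ξ : ℂ) * g ξ

/-- The symbol function `σ(ξ) = ∑_{k ∈ ℤ} φ̂(ξ + 2πk)`. -/
def symbol (c ξ : ℝ) : ℝ := ∑' k : ℤ, phiHat c (ξ + 2 * Real.pi * k)

/-- A finitely supported complex sequence is zero-summing if `∑ y_j = 0`. -/
def IsZeroSumming (y : ℤ →₀ ℂ) : Prop := ∑ j ∈ y.support, y j = 0

/-- The quadratic form `∑_{j,k ∈ ℤ} y_j conj(y_k) φ(j - k)`. -/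
def quadForm (c : ℝ) (y : ℤ →₀ ℂ) : ℂ :=
  ∑ j ∈ y.support, ∑ k ∈ y.support,
    y j * (starRingEnd ℂ) (y k) * (phi c ((j : ℝ) - (k : ℝ)) : ℂ)

/-- The squared norm `∑_{j ∈ ℤ} |y_j|²`. -/
def normSqSum (y : ℤ →₀ ℂ) : ℝ := ∑ j ∈ y.support, ‖y j‖ ^ 2

end Multiquadric

end

/-!
Write `a = |c|`. The multiquadric is a mixture of Gaussians,
`√π φ(x) = ∫₀^∞ (1 - exp(-(x² + c²)v²)) v⁻² dv` (`integral_gaussian_defect`), and the mixture of the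
Fourier transforms of those Gaussians is the Bessel kernel:
`-φ̂(ξ) = ∫₀^∞ v⁻³ exp(-c²v² - ξ²/(4v²)) dv = (2/ξ²) G(ξ)`, where
`G(ξ) = ∫₀^∞ exp(-w - c²ξ²/(4w)) dw = a|ξ| K₁(a|ξ|)` is continuous with values in `[0, 1]`
(`phiHat_eq`, `integral_mixture`).

For the distributional identity, insert the mixture into `∫ φ ĝ`, interchange integrals, and
evaluate for fixed `v`: the constant `1` contributes a multiple of `∫ ĝ = 2π g(0) = 0`, and the
Gaussian is transformed explicitly. Interchanging back gives `∫ φ̂ g`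
(`isGeneralizedFourierTransform_phiHat`).

For the symbol, let `ψ(x) = 2φ(x) - φ(x + 1) - φ(x - 1)`. The same mixture shows that `ψ` is the
inverse Fourier transform of `H(ξ) = (2 - 2 cos ξ) φ̂(ξ)`, which is continuous on the whole line and
`O(ξ⁻²)` (`phiDiff_eq_integral`). As `ψ` is summable over `ℤ`, Poisson summation yields
`∑ₘ ψ(m) e^{imη} = (2 - 2 cos η) σ(η)` (`hasSum_phiDiff_mul_exp`).

The test sequences are differences of truncated exponentials,
`y⁽ⁿ⁾ = ∑_{j < n} e^{ijη} (δ_j - δ_{j+1})`. For a kernel `κ` whose second difference is summable, the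
form `∑ y_j conj(y_k) κ(j - k)` divided by `n` is a Cesàro mean of the twisted series
`∑ₘ (2κ(m) - κ(m + 1) - κ(m - 1)) e^{imη}` and converges to its sum
(`tendsto_kernelForm_diffExp`). With `κ = φ` the limit is `(2 - 2 cos η) σ(η)`; with `κ = δ₀` the form
is `∑ |y_j|²` and the limit is `2 - 2 cos η ≠ 0`. The quotient tends to `σ(η)`.
-/

open MeasureTheory Set Filter Topology
open scoped FourierTransform SchwartzMap ComplexConjugate

namespace Multiquadric

/-! ### The Bessel function as a Laplace-type integral -/

/-- The function `G(ξ) = ∫₀^∞ exp(-w - c²ξ²/(4w)) dw`. For `ξ ≠ 0` it equals `z K₁(z)` with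
`z = |c||ξ|`; unlike the Bessel form it makes sense at `ξ = 0`, is continuous there, and is
visibly at most `1`. -/
noncomputable def profile (c ξ : ℝ) : ℝ :=
  ∫ w in Ioi (0 : ℝ), Real.exp (-w - c ^ 2 * ξ ^ 2 / (4 * w))

theorem profile_integrand_le (c ξ : ℝ) {w : ℝ} (hw : 0 < w) :
    Real.exp (-w - c ^ 2 * ξ ^ 2 / (4 * w)) ≤ Real.exp (-w) := by
  apply Real.exp_le_exp.2
  have : 0 ≤ c ^ 2 * ξ ^ 2 / (4 * w) := by positivity
  linarith

theorem integrableOn_exp_neg : IntegrableOn (fun w : ℝ => Real.exp (-w)) (Ioi 0) := by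
  simpa using exp_neg_integrableOn_Ioi 0 one_pos

theorem measurable_profile_integrand (c ξ : ℝ) :
    Measurable fun w : ℝ => Real.exp (-w - c ^ 2 * ξ ^ 2 / (4 * w)) := by fun_prop

theorem integrableOn_profile_integrand (c ξ : ℝ) :
    IntegrableOn (fun w : ℝ => Real.exp (-w - c ^ 2 * ξ ^ 2 / (4 * w))) (Ioi 0) := by
  refine integrableOn_exp_neg.mono' (measurable_profile_integrand c ξ).aestronglyMeasurable ?_
  refine (ae_restrict_iff' measurableSet_Ioi).2 (ae_of_all _ fun w hw => ?_)
  rw [Real.norm_of_nonneg (Real.exp_nonneg _)]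
  exact profile_integrand_le c ξ hw

theorem profile_nonneg (c ξ : ℝ) : 0 ≤ profile c ξ :=
  integral_nonneg fun _ => Real.exp_nonneg _

theorem profile_le_one (c ξ : ℝ) : profile c ξ ≤ 1 := by
  rw [← integral_exp_neg_Ioi_zero]
  exact setIntegral_mono_on (integrableOn_profile_integrand c ξ) integrableOn_exp_neg
    measurableSet_Ioi fun w hw => profile_integrand_le c ξ hw

theorem continuous_profile (c : ℝ) : Continuous (profile c) := by
  refine continuous_of_dominated (bound := fun w => Real.exp (-w))
    (fun ξ => (measurable_profile_integrand c ξ).aestronglyMeasurable) (fun ξ => ?_)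
    integrableOn_exp_neg (ae_of_all _ fun w => by fun_prop)
  refine (ae_restrict_iff' measurableSet_Ioi).2 (ae_of_all _ fun w hw => ?_)
  rw [Real.norm_of_nonneg (Real.exp_nonneg _)]
  exact profile_integrand_le c ξ hw

theorem image_univ_const_mul_exp {κ : ℝ} (hκ : 0 < κ) :
    (fun t : ℝ => κ * Real.exp t) '' univ = Ioi 0 := by
  ext w
  simp only [image_univ, mem_range, mem_Ioi]
  constructor
  · rintro ⟨t, rfl⟩
    positivity
  · intro hw
    refine ⟨Real.log (w / κ), ?_⟩
    rw [Real.exp_log (by positivity)]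
    field_simp

/-- The substitution `w = (z/2) eᵗ`, `z = |c||ξ|`, turns `G(ξ)` into
`(z/2) ∫ exp(-z cosh t) eᵗ dt` over the whole line; the even part of `eᵗ` is `cosh t`. -/
theorem profile_eq_besselK {c ξ : ℝ} (hc : c ≠ 0) (hξ : ξ ≠ 0) :
    profile c ξ = |c| * |ξ| * besselK 1 (|c| * |ξ|) := by
  have hz : 0 < |c| * |ξ| := by positivity
  have hsq : c ^ 2 * ξ ^ 2 = (|c| * |ξ|) ^ 2 := by rw [mul_pow, sq_abs, sq_abs]
  have hint := integrableOn_profile_integrand c ξ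
  have hval : profile c ξ = ∫ w in Ioi (0 : ℝ), Real.exp (-w - c ^ 2 * ξ ^ 2 / (4 * w)) := rfl
  rw [hval]
  unfold besselK
  rw [hsq] at hint ⊢
  set z := |c| * |ξ|
  have hκ : 0 < z / 2 := by positivity
  have hd : ∀ t ∈ (univ : Set ℝ), HasDerivWithinAt (fun t : ℝ => z / 2 * Real.exp t)
      (z / 2 * Real.exp t) univ t := fun t _ =>
    ((Real.hasDerivAt_exp t).const_mul _).hasDerivWithinAt
  have hinj : InjOn (fun t : ℝ => z / 2 * Real.exp t) univ := by
    intro s _ t _ h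
    exact Real.exp_injective (mul_left_cancel₀ hκ.ne' h)
  have key : ∀ t : ℝ, |z / 2 * Real.exp t| •
      Real.exp (-(z / 2 * Real.exp t) - z ^ 2 / (4 * (z / 2 * Real.exp t))) =
      z / 2 * (Real.exp (-z * Real.cosh t) * Real.exp t) := by
    intro t
    rw [abs_of_pos (by positivity), smul_eq_mul]
    have : -(z / 2 * Real.exp t) - z ^ 2 / (4 * (z / 2 * Real.exp t)) = -z * Real.cosh t := by
      rw [Real.cosh_eq, Real.exp_neg]
      have := Real.exp_pos t
      field_simp
      ring
    rw [this]
    ring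
  rw [← image_univ_const_mul_exp hκ,
    integrableOn_image_iff_integrableOn_abs_deriv_smul MeasurableSet.univ hd hinj] at hint
  have him := image_univ_const_mul_exp hκ
  conv_lhs => rw [← him]
  rw [integral_image_eq_integral_abs_deriv_smul MeasurableSet.univ hd hinj]
  simp only [key] at hint ⊢
  rw [integrableOn_univ] at hint
  rw [setIntegral_univ, integral_const_mul]
  have hA : Integrable fun t : ℝ => Real.exp (-z * Real.cosh t) * Real.exp t := by
    have := hint.const_mul (z / 2)⁻¹
    refine this.congr (ae_of_all _ fun t => ?_)
    field_simp
  have h2 := integral_comp_abs (f := fun t : ℝ => Real.exp (-z * Real.cosh t) * Real.cosh (1 * t))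
  have h3 : (∫ t : ℝ, Real.exp (-z * Real.cosh t) * Real.exp t) =
      ∫ t : ℝ, Real.exp (-z * Real.cosh |t|) * Real.cosh (1 * |t|) := by
    have hn : (∫ t : ℝ, Real.exp (-z * Real.cosh t) * Real.exp (-t)) =
        ∫ t : ℝ, Real.exp (-z * Real.cosh t) * Real.exp t := by
      rw [← integral_neg_eq_self]
      simp
    have hA' : Integrable fun t : ℝ => Real.exp (-z * Real.cosh t) * Real.exp (-t) := by
      simpa using hA.comp_neg
    have : (∫ t : ℝ, Real.exp (-z * Real.cosh |t|) * Real.cosh (1 * |t|)) =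
        ∫ t : ℝ, (1 / 2) * (Real.exp (-z * Real.cosh t) * Real.exp t +
          Real.exp (-z * Real.cosh t) * Real.exp (-t)) := by
      congr 1 with t
      rw [one_mul, Real.cosh_abs, Real.cosh_eq]
      ring
    rw [this, integral_const_mul, integral_add hA hA', hn]
    ring
  rw [h3, h2]
  ring

theorem phiHat_eq {c ξ : ℝ} (hc : c ≠ 0) (hξ : ξ ≠ 0) :
    phiHat c ξ = -(2 / ξ ^ 2 * profile c ξ) := by
  rw [profile_eq_besselK hc hξ, phiHat, ← sq_abs ξ]
  have : 0 < |ξ| := by positivity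
  field_simp

/-! ### Gaussian mixtures -/

/-- The kernel `v⁻³ exp(-c²v² - ξ²/(4v²))`. For fixed `v > 0` it is, up to a constant, the Fourier
transform in `x` of `v⁻² exp(-(x² + c²)v²)`; integrated over `v > 0` it gives `-φ̂(ξ)`. -/
noncomputable def mixture (c v ξ : ℝ) : ℝ :=
  Real.exp (-(c ^ 2 * v ^ 2)) * Real.exp (-(ξ ^ 2 / (4 * v ^ 2))) / v ^ 3

theorem mixture_nonneg {c v ξ : ℝ} (hv : 0 < v) : 0 ≤ mixture c v ξ := by
  unfold mixture; positivity

/-- Both parts follow from the substitution `w = ξ²/(4v²)` in the integral `profile c ξ`. -/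
theorem integral_mixture (c : ℝ) {ξ : ℝ} (hξ : ξ ≠ 0) :
    IntegrableOn (fun v => mixture c v ξ) (Ioi 0) ∧
      ∫ v in Ioi (0 : ℝ), mixture c v ξ = 2 / ξ ^ 2 * profile c ξ := by
  have hx : 0 < ξ ^ 2 := by positivity
  have hd : ∀ v ∈ Ioi (0 : ℝ), HasDerivWithinAt (fun v : ℝ => ξ ^ 2 / (4 * v ^ 2))
      (-(ξ ^ 2 / (2 * v ^ 3))) (Ioi 0) v := by
    intro v hv
    have hv : 0 < v := hv
    have h1 : HasDerivAt (fun v : ℝ => 4 * v ^ 2) (4 * (2 * v)) v := by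
      simpa using (hasDerivAt_pow 2 v).const_mul 4
    have h2 := (hasDerivAt_const v (ξ ^ 2)).div h1 (by positivity)
    refine (h2.congr_deriv ?_).hasDerivWithinAt
    field_simp
    ring
  have hinj : InjOn (fun v : ℝ => ξ ^ 2 / (4 * v ^ 2)) (Ioi 0) := by
    intro s hs t ht h
    have hs : 0 < s := hs
    have ht : 0 < t := ht
    have h : ξ ^ 2 / (4 * s ^ 2) = ξ ^ 2 / (4 * t ^ 2) := h
    field_simp at h
    exact (pow_left_inj₀ ht.le hs.le two_ne_zero).1 h |>.symm
  have him : (fun v : ℝ => ξ ^ 2 / (4 * v ^ 2)) '' Ioi 0 = Ioi 0 := by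
    ext w
    constructor
    · rintro ⟨v, hv, rfl⟩
      have hv : 0 < v := hv
      exact mem_Ioi.2 (by positivity)
    · intro hw
      have hw : 0 < w := hw
      refine ⟨Real.sqrt (ξ ^ 2 / (4 * w)), mem_Ioi.2 (Real.sqrt_pos.2 (by positivity)), ?_⟩
      simp only
      rw [Real.sq_sqrt (by positivity)]
      field_simp
  have key : ∀ v ∈ Ioi (0 : ℝ), |(-(ξ ^ 2 / (2 * v ^ 3)))| •
      Real.exp (-(ξ ^ 2 / (4 * v ^ 2)) - c ^ 2 * ξ ^ 2 / (4 * (ξ ^ 2 / (4 * v ^ 2)))) =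
      ξ ^ 2 / 2 * mixture c v ξ := by
    intro v hv
    have hv : 0 < v := hv
    have e : c ^ 2 * ξ ^ 2 / (4 * (ξ ^ 2 / (4 * v ^ 2))) = c ^ 2 * v ^ 2 := by
      field_simp
    rw [e, abs_neg, abs_of_pos (by positivity), smul_eq_mul, mixture, sub_eq_add_neg, Real.exp_add]
    field_simp
  have hint := integrableOn_profile_integrand c ξ
  have hval : profile c ξ = ∫ w in Ioi (0 : ℝ), Real.exp (-w - c ^ 2 * ξ ^ 2 / (4 * w)) := rfl
  rw [← him] at hint hval
  rw [integrableOn_image_iff_integrableOn_abs_deriv_smul measurableSet_Ioi hd hinj,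
    integrableOn_congr_fun key measurableSet_Ioi] at hint
  rw [integral_image_eq_integral_abs_deriv_smul measurableSet_Ioi hd hinj,
    setIntegral_congr_fun measurableSet_Ioi key, integral_const_mul] at hval
  constructor
  · have := hint.const_mul (2 / ξ ^ 2)
    refine this.congr (ae_of_all _ fun v => ?_)
    field_simp
  · rw [hval]
    field_simp

theorem gaussian_defect_bound {s v : ℝ} (hv : 0 < v) :
    (1 - Real.exp (-s * v ^ 2)) / v ^ 2 ≤ s := by
  rw [div_le_iff₀ (by positivity)]
  have := Real.add_one_le_exp (-s * v ^ 2)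
  linarith

theorem gaussian_defect_nonneg {s v : ℝ} (hs : 0 < s) :
    0 ≤ (1 - Real.exp (-s * v ^ 2)) / v ^ 2 := by
  have : Real.exp (-s * v ^ 2) ≤ 1 :=
    Real.exp_le_one_iff.2 (by linarith [mul_nonneg hs.le (sq_nonneg v)])
  exact div_nonneg (by linarith) (by positivity)

theorem integrableOn_gaussian_defect {s : ℝ} (hs : 0 < s) :
    IntegrableOn (fun v : ℝ => (1 - Real.exp (-s * v ^ 2)) / v ^ 2) (Ioi 0) := by
  have hm : Measurable fun v : ℝ => (1 - Real.exp (-s * v ^ 2)) / v ^ 2 := by fun_prop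
  rw [← Ioc_union_Ioi_eq_Ioi zero_le_one]
  refine IntegrableOn.union ?_ ?_
  · refine Integrable.mono' (g := fun _ => s) (by simp) hm.aestronglyMeasurable ?_
    refine (ae_restrict_iff' measurableSet_Ioc).2 (ae_of_all _ fun v hv => ?_)
    rw [Real.norm_of_nonneg (gaussian_defect_nonneg hs)]
    exact gaussian_defect_bound hv.1
  · refine Integrable.mono' (g := fun v : ℝ => v ^ (-2 : ℝ))
      (integrableOn_Ioi_rpow_of_lt (by norm_num) one_pos) hm.aestronglyMeasurable ?_
    refine (ae_restrict_iff' measurableSet_Ioi).2 (ae_of_all _ fun v hv => ?_)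
    have hv : (1 : ℝ) < v := hv
    rw [Real.norm_of_nonneg (gaussian_defect_nonneg hs), Real.rpow_neg (by linarith),
      ← one_div]
    norm_cast
    gcongr
    linarith [Real.exp_pos (-s * v ^ 2)]

/-- The derivative of `-(1 - exp(-sv²))/v` is the integrand minus the Gaussian `2s exp(-sv²)`, and
this antiderivative vanishes at both ends of `(0, ∞)`. -/
theorem integral_gaussian_defect {s : ℝ} (hs : 0 < s) :
    ∫ v in Ioi (0 : ℝ), (1 - Real.exp (-s * v ^ 2)) / v ^ 2 = Real.sqrt Real.pi * Real.sqrt s := by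
  have hg : IntegrableOn (fun v : ℝ => 2 * s * Real.exp (-s * v ^ 2)) (Ioi 0) :=
    ((integrable_exp_neg_mul_sq hs).const_mul _).integrableOn
  have hd := integrableOn_gaussian_defect hs
  have habs : ∀ v : ℝ, 0 ≤ v → 0 ≤ (1 - Real.exp (-s * v ^ 2)) / v := by
    intro v hv
    have : Real.exp (-s * v ^ 2) ≤ 1 := Real.exp_le_one_iff.2 (by nlinarith [sq_nonneg v])
    exact div_nonneg (by linarith) hv
  -- At `v = 0` the quotient is `0` by the convention for division by zero, which is also its limit.
  have hcont : ContinuousWithinAt (fun v : ℝ => -((1 - Real.exp (-s * v ^ 2)) / v)) (Ici 0) 0 := by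
    have h0 : Tendsto (fun v : ℝ => s * v) (𝓝[Ici 0] 0) (𝓝 0) := by
      have : Tendsto (fun v : ℝ => s * v) (𝓝 0) (𝓝 (s * 0)) := (continuous_const_mul s).tendsto 0
      rw [mul_zero] at this
      exact this.mono_left nhdsWithin_le_nhds
    have h1 : Tendsto (fun v : ℝ => (1 - Real.exp (-s * v ^ 2)) / v) (𝓝[Ici 0] 0) (𝓝 0) := by
      refine squeeze_zero' ?_ ?_ h0
      · filter_upwards [self_mem_nhdsWithin] with v hv using habs v hv
      · filter_upwards [self_mem_nhdsWithin] with v hv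
        rcases (show (0 : ℝ) ≤ v from hv).eq_or_lt with rfl | hv
        · simp
        · rw [div_le_iff₀ hv]
          nlinarith [Real.add_one_le_exp (-s * v ^ 2)]
    simpa [ContinuousWithinAt] using h1.neg
  have hlim : Tendsto (fun v : ℝ => -((1 - Real.exp (-s * v ^ 2)) / v)) atTop (𝓝 0) := by
    have h1 : Tendsto (fun v : ℝ => (1 - Real.exp (-s * v ^ 2)) / v) atTop (𝓝 0) := by
      refine squeeze_zero' ?_ ?_ tendsto_inv_atTop_zero
      · filter_upwards [eventually_ge_atTop 0] with v hv using habs v hv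
      · filter_upwards [eventually_gt_atTop 0] with v hv
        rw [← one_div]
        gcongr
        linarith [Real.exp_pos (-s * v ^ 2)]
    simpa using h1.neg
  have hderiv : ∀ v ∈ Ioi (0 : ℝ), HasDerivAt (fun v : ℝ => -((1 - Real.exp (-s * v ^ 2)) / v))
      ((1 - Real.exp (-s * v ^ 2)) / v ^ 2 - 2 * s * Real.exp (-s * v ^ 2)) v := by
    intro v hv
    have hv : 0 < v := hv
    have h1 : HasDerivAt (fun v : ℝ => -s * v ^ 2) (-s * (2 * v)) v := by
      simpa using (hasDerivAt_pow 2 v).const_mul (-s)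
    refine (((h1.exp.const_sub 1).div (hasDerivAt_id v) hv.ne').neg).congr_deriv ?_
    simp only [id]
    field_simp
    ring
  have h := integral_Ioi_of_hasDerivAt_of_tendsto hcont hderiv (hd.sub hg) hlim
  rw [integral_sub hd hg, integral_const_mul, integral_gaussian_Ioi] at h
  simp only [div_zero, neg_zero, sub_zero] at h
  rw [sub_eq_zero.1 h, Real.sqrt_div Real.pi_pos.le]
  have : Real.sqrt s * Real.sqrt s = s := Real.mul_self_sqrt hs.le
  have hp : 0 < Real.sqrt s := Real.sqrt_pos.2 hs
  field_simp
  nlinarith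

/-! ### The generalized Fourier transform of the multiquadric -/

theorem phi_eq_integral {c : ℝ} (hc : c ≠ 0) (x : ℝ) :
    phi c x = (Real.sqrt Real.pi)⁻¹ *
      ∫ v in Ioi (0 : ℝ), (1 - Real.exp (-(x ^ 2 + c ^ 2) * v ^ 2)) / v ^ 2 := by
  have hs : 0 < x ^ 2 + c ^ 2 := by positivity
  rw [integral_gaussian_defect hs, phi, inv_mul_cancel_left₀ (Real.sqrt_pos.2 Real.pi_pos).ne']

theorem phi_nonneg (c x : ℝ) : 0 ≤ phi c x := Real.sqrt_nonneg _

theorem phi_le (c x : ℝ) : phi c x ≤ |x| + |c| := by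
  rw [phi]
  refine Real.sqrt_le_iff.2 ⟨by positivity, ?_⟩
  nlinarith [sq_abs x, sq_abs c, mul_nonneg (abs_nonneg x) (abs_nonneg c)]

theorem continuous_phi (c : ℝ) : Continuous (phi c) := by unfold phi; fun_prop

theorem integral_exp_mul_gaussian {b : ℝ} (hb : 0 < b) (t : ℝ) :
    ∫ x : ℝ, Complex.exp (Complex.I * t * x) * (Real.exp (-b * x ^ 2) : ℂ) =
      (Real.sqrt (Real.pi / b) * Real.exp (-t ^ 2 / (4 * b)) : ℝ) := by
  have h := fourierIntegral_gaussian (b := (b : ℂ)) (by simpa using hb) (t : ℂ)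
  push_cast
  rw [h, Real.sqrt_eq_rpow, Complex.ofReal_cpow (by positivity)]
  push_cast
  rfl

/-- The Fourier transform `ĝ(x) = ∫ g(ξ) e^{-ixξ} dξ`, in the angular normalization. -/
noncomputable def angularFourier (g : ℝ → ℂ) (x : ℝ) : ℂ :=
  ∫ ξ : ℝ, g ξ * Complex.exp (-Complex.I * x * ξ)

theorem angularFourier_eq_fourier (g : 𝓢(ℝ, ℂ)) (x : ℝ) :
    angularFourier g x = (𝓕 g : 𝓢(ℝ, ℂ)) (x * (2 * Real.pi)⁻¹) := by
  rw [SchwartzMap.fourier_coe, Real.fourier_eq', angularFourier]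
  congr 1 with ξ
  rw [smul_eq_mul, mul_comm]
  congr 2
  simp only [RCLike.inner_apply, conj_trivial]
  push_cast
  have : (Real.pi : ℂ) ≠ 0 := by exact_mod_cast Real.pi_ne_zero
  field_simp

theorem integrable_angularFourier (g : 𝓢(ℝ, ℂ)) : Integrable (angularFourier g) := by
  rw [funext (angularFourier_eq_fourier g)]
  exact ((𝓕 g : 𝓢(ℝ, ℂ)).integrable).comp_mul_right' (by positivity)

theorem continuous_angularFourier (g : 𝓢(ℝ, ℂ)) : Continuous (angularFourier g) := by
  rw [funext (angularFourier_eq_fourier g)]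
  exact (𝓕 g : 𝓢(ℝ, ℂ)).continuous.comp (by fun_prop)

theorem integral_angularFourier (g : 𝓢(ℝ, ℂ)) :
    ∫ x : ℝ, angularFourier g x = 2 * Real.pi * g 0 := by
  rw [funext (angularFourier_eq_fourier g),
    Measure.integral_comp_mul_right (fun x => (𝓕 g : 𝓢(ℝ, ℂ)) x)]
  have h : (𝓕⁻ (𝓕 g) : 𝓢(ℝ, ℂ)) 0 = g 0 := by rw [FourierTransform.fourierInv_fourier_eq]
  rw [SchwartzMap.fourierInv_coe, Real.fourierInv_eq'] at h
  simp only [inner_zero_right, mul_zero, Complex.ofReal_zero, zero_mul, Complex.exp_zero,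
    one_smul] at h
  rw [h, inv_inv, abs_of_pos (by positivity), Complex.real_smul]
  push_cast
  rfl

theorem integrable_phi_mul_angularFourier (c : ℝ) (g : 𝓢(ℝ, ℂ)) :
    Integrable fun x => (phi c x : ℂ) * angularFourier g x := by
  have h1 : Integrable fun x : ℝ => ‖x‖ * ‖angularFourier g x‖ := by
    have h := ((SchwartzMap.integrable_pow_mul volume (𝓕 g : 𝓢(ℝ, ℂ)) 1).comp_mul_right'
      (R := (2 * Real.pi)⁻¹) (by positivity)).const_mul (2 * Real.pi)
    refine h.congr (ae_of_all _ fun x => ?_)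
    simp only [angularFourier_eq_fourier, norm_mul, pow_one, norm_inv]
    rw [Real.norm_of_nonneg Real.pi_pos.le, Real.norm_ofNat]
    have := Real.pi_pos
    field_simp
  have h2 := (integrable_angularFourier g).norm.const_mul |c|
  refine (h1.add h2).mono' (((Complex.continuous_ofReal.comp (continuous_phi c)).mul
    (continuous_angularFourier g)).aestronglyMeasurable) (ae_of_all _ fun x => ?_)
  simp only [norm_mul, Pi.add_apply, Complex.norm_real, Real.norm_of_nonneg (phi_nonneg c x)]
  rw [← add_mul]
  gcongr
  exact phi_le c x

theorem integral_gaussian_mul_angularFourier (g : 𝓢(ℝ, ℂ)) {v : ℝ} (hv : 0 < v) :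
    ∫ x : ℝ, (Real.exp (-v ^ 2 * x ^ 2) : ℂ) * angularFourier g x =
      ∫ ξ : ℝ, (Real.sqrt Real.pi / v * Real.exp (-(ξ ^ 2 / (4 * v ^ 2))) : ℝ) * g ξ := by
  have hb : 0 < v ^ 2 := by positivity
  have hswap : Integrable (Function.uncurry fun x ξ : ℝ =>
      (Real.exp (-v ^ 2 * x ^ 2) : ℂ) * (g ξ * Complex.exp (-Complex.I * x * ξ)))
      (volume.prod volume) := by
    have h := (integrable_exp_neg_mul_sq hb).ofReal (𝕜 := ℂ) |>.mul_prod
      (g.integrable (μ := volume))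
    refine h.mono ?_ (ae_of_all _ fun p => ?_)
    · have := g.continuous
      exact Continuous.aestronglyMeasurable (by simp only [Function.uncurry_def]; fun_prop)
    · have : ‖Complex.exp (-Complex.I * p.1 * p.2)‖ = 1 := by
        rw [Complex.norm_exp]; simp
      simp only [Function.uncurry_def, norm_mul, this, mul_one]
      rfl
  calc _ = ∫ x : ℝ, ∫ ξ : ℝ,
        (Real.exp (-v ^ 2 * x ^ 2) : ℂ) * (g ξ * Complex.exp (-Complex.I * x * ξ)) := by
        congr 1 with x
        rw [angularFourier, integral_const_mul]
    _ = ∫ ξ : ℝ, ∫ x : ℝ,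
        (Real.exp (-v ^ 2 * x ^ 2) : ℂ) * (g ξ * Complex.exp (-Complex.I * x * ξ)) :=
        integral_integral_swap hswap
    _ = _ := by
        congr 1 with ξ
        have h := integral_exp_mul_gaussian hb (-ξ)
        have e : Real.sqrt (Real.pi / v ^ 2) = Real.sqrt Real.pi / v := by
          rw [Real.sqrt_div Real.pi_pos.le, Real.sqrt_sq hv.le]
        rw [e, neg_sq, neg_div] at h
        rw [← h, ← integral_mul_const]
        congr 1 with x
        have : -Complex.I * x * ξ = Complex.I * (-ξ : ℝ) * x := by push_cast; ring
        rw [this]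
        ring

/-- The constant term of the Gaussian defect pairs with `ĝ` to a multiple of `∫ ĝ = 2π g(0)`, hence
drops out; the Gaussian term is moved to the Fourier side. -/
theorem integral_gaussian_defect_mul_angularFourier (c : ℝ) {g : 𝓢(ℝ, ℂ)} (hg : g 0 = 0)
    {v : ℝ} (hv : 0 < v) :
    ∫ x : ℝ, ((1 - Real.exp (-(x ^ 2 + c ^ 2) * v ^ 2)) / v ^ 2 : ℝ) * angularFourier g x =
      -(Real.sqrt Real.pi * ∫ ξ : ℝ, (mixture c v ξ : ℂ) * g ξ) := by
  have hb : 0 < v ^ 2 := by positivity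
  have hi := integrable_angularFourier g
  have hi2 : Integrable fun x : ℝ => (Real.exp (-v ^ 2 * x ^ 2) : ℂ) * angularFourier g x := by
    refine hi.mono ?_ (ae_of_all _ fun x => ?_)
    · have := continuous_angularFourier g
      exact Continuous.aestronglyMeasurable (by fun_prop)
    · rw [norm_mul, Complex.norm_real, Real.norm_of_nonneg (Real.exp_nonneg _)]
      refine mul_le_of_le_one_left (norm_nonneg _) (Real.exp_le_one_iff.2 ?_)
      linarith [mul_nonneg hb.le (sq_nonneg x)]
  have e : ∀ x : ℝ,
      (((1 - Real.exp (-(x ^ 2 + c ^ 2) * v ^ 2)) / v ^ 2 : ℝ) : ℂ) * angularFourier g x =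
      ((v ^ 2)⁻¹ : ℝ) * angularFourier g x - (Real.exp (-(c ^ 2 * v ^ 2)) / v ^ 2 : ℝ) *
        ((Real.exp (-v ^ 2 * x ^ 2) : ℂ) * angularFourier g x) := by
    intro x
    have : -(x ^ 2 + c ^ 2) * v ^ 2 = -(c ^ 2 * v ^ 2) + -v ^ 2 * x ^ 2 := by ring
    rw [this, Real.exp_add]
    push_cast
    ring
  simp only [e]
  rw [integral_sub (hi.const_mul _) (hi2.const_mul _), integral_const_mul, integral_const_mul,
    integral_angularFourier, hg, integral_gaussian_mul_angularFourier g hv, mul_zero, mul_zero,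
    zero_sub, ← integral_const_mul, ← integral_const_mul]
  congr 2 with ξ
  rw [mixture]
  push_cast
  have : (v : ℂ) ≠ 0 := by exact_mod_cast hv.ne'
  field_simp

theorem phiHat_mul_eq {c : ℝ} (hc : c ≠ 0) {g : ℝ → ℂ} (hg : g 0 = 0) (ξ : ℝ) :
    (phiHat c ξ : ℂ) * g ξ = -((2 / ξ ^ 2 * profile c ξ : ℝ) * g ξ) := by
  rcases eq_or_ne ξ 0 with rfl | hξ
  · simp [hg]
  · rw [phiHat_eq hc hξ]
    push_cast
    ring

theorem integrable_profile_mul {c : ℝ} {g : 𝓢(ℝ, ℂ)}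
    (hg : (0 : ℝ) ∉ tsupport fun ξ => g ξ) :
    Integrable fun ξ : ℝ => ((2 / ξ ^ 2 * profile c ξ : ℝ) : ℂ) * g ξ := by
  obtain ⟨δ, hδ, hball⟩ := Metric.eventually_nhds_iff.1 (notMem_tsupport_iff_eventuallyEq.1 hg)
  refine (g.integrable.norm.const_mul (2 / δ ^ 2)).mono' ?_ (ae_of_all _ fun ξ => ?_)
  · have := (continuous_profile c).measurable
    have := g.continuous.measurable
    exact Measurable.aestronglyMeasurable (by fun_prop)
  · by_cases h : |ξ| < δ
    · have : g ξ = 0 := hball (by simpa using h)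
      simp [this]
    · push Not at h
      rw [norm_mul, Complex.norm_real, Real.norm_of_nonneg
        (mul_nonneg (by positivity) (profile_nonneg c ξ))]
      gcongr
      have h2 : δ ^ 2 ≤ ξ ^ 2 := by rw [← sq_abs ξ]; gcongr
      calc 2 / ξ ^ 2 * profile c ξ ≤ 2 / ξ ^ 2 * 1 := by
            gcongr; exact profile_le_one c ξ
        _ ≤ 2 / δ ^ 2 := by rw [mul_one]; gcongr

theorem isGeneralizedFourierTransform_phiHat {c : ℝ} (hc : c ≠ 0) :
    IsGeneralizedFourierTransform (phi c) (phiHat c) := by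
  intro g hg
  have hg0 : g 0 = 0 := image_eq_zero_of_notMem_tsupport hg
  have hspi : (Real.sqrt Real.pi : ℂ) ≠ 0 := by
    exact_mod_cast (Real.sqrt_pos.2 Real.pi_pos).ne'
  have hI1 := integrable_phi_mul_angularFourier c g
  have hI2 := integrable_profile_mul (c := c) hg
  refine ⟨hI1, ?_, ?_⟩
  · rw [funext (phiHat_mul_eq hc (g := g) hg0)]
    exact hI2.neg
  change ∫ x : ℝ, (phi c x : ℂ) * angularFourier g x = _
  have hpos : ∀ x : ℝ, 0 < x ^ 2 + c ^ 2 := fun x => by positivity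
  have hgm := g.continuous.measurable
  have ham := (continuous_angularFourier g).measurable
  have hswap1 : Integrable (Function.uncurry fun x v : ℝ =>
      ((1 - Real.exp (-(x ^ 2 + c ^ 2) * v ^ 2)) / v ^ 2 : ℝ) * angularFourier g x)
      (volume.prod (volume.restrict (Ioi 0))) := by
    refine (integrable_prod_iff (Measurable.aestronglyMeasurable
      (by simp only [Function.uncurry_def]; fun_prop))).2 ⟨ae_of_all _ fun x => ?_, ?_⟩
    · exact (integrableOn_gaussian_defect (hpos x)).ofReal (𝕜 := ℂ) |>.mul_const (angularFourier g x)
    · refine (hI1.norm.const_mul (Real.sqrt Real.pi)).congr (ae_of_all _ fun x => ?_)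
      simp only [Function.uncurry_apply_pair, norm_mul, Complex.norm_real,
        Real.norm_of_nonneg (gaussian_defect_nonneg (hpos x)), Real.norm_of_nonneg (phi_nonneg c x)]
      rw [integral_mul_const, integral_gaussian_defect (hpos x), phi]
      ring
  have hswap2 : Integrable (Function.uncurry fun ξ v : ℝ => (mixture c v ξ : ℂ) * g ξ)
      (volume.prod (volume.restrict (Ioi 0))) := by
    refine (integrable_prod_iff (Measurable.aestronglyMeasurable
      (by simp only [Function.uncurry_def, mixture]; fun_prop))).2 ⟨ae_of_all _ fun ξ => ?_, ?_⟩
    · rcases eq_or_ne ξ 0 with rfl | hξ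
      · simp [hg0]
      · exact (integral_mixture c hξ).1.ofReal (𝕜 := ℂ) |>.mul_const (g ξ)
    · refine hI2.norm.congr (ae_of_all _ fun ξ => ?_)
      rcases eq_or_ne ξ 0 with rfl | hξ
      · simp [hg0]
      · simp only [Function.uncurry_apply_pair, norm_mul, Complex.norm_real]
        rw [integral_mul_const, ← norm_mul, ← (integral_mixture c hξ).2, Real.norm_of_nonneg
          (setIntegral_nonneg measurableSet_Ioi fun v hv => mixture_nonneg hv)]
        congr 1
        exact setIntegral_congr_fun measurableSet_Ioi fun v hv =>
          (Real.norm_of_nonneg (mixture_nonneg hv)).symm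
  calc ∫ x : ℝ, (phi c x : ℂ) * angularFourier g x
      = (Real.sqrt Real.pi : ℂ)⁻¹ * ∫ x : ℝ, ∫ v in Ioi (0 : ℝ),
        (((1 - Real.exp (-(x ^ 2 + c ^ 2) * v ^ 2)) / v ^ 2 : ℝ) : ℂ) * angularFourier g x := by
        rw [← integral_const_mul]
        congr 1 with x
        rw [integral_mul_const, integral_complex_ofReal, phi_eq_integral hc x]
        push_cast
        ring
    _ = (Real.sqrt Real.pi : ℂ)⁻¹ * ∫ v in Ioi (0 : ℝ), ∫ x : ℝ,
        (((1 - Real.exp (-(x ^ 2 + c ^ 2) * v ^ 2)) / v ^ 2 : ℝ) : ℂ) * angularFourier g x := by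
        rw [integral_integral_swap hswap1]
    _ = -∫ v in Ioi (0 : ℝ), ∫ ξ : ℝ, (mixture c v ξ : ℂ) * g ξ := by
        rw [setIntegral_congr_fun measurableSet_Ioi fun v hv =>
          integral_gaussian_defect_mul_angularFourier c hg0 hv, integral_neg, integral_const_mul]
        field_simp
    _ = -∫ ξ : ℝ, ∫ v in Ioi (0 : ℝ), (mixture c v ξ : ℂ) * g ξ := by
        rw [integral_integral_swap hswap2]
    _ = ∫ ξ : ℝ, (phiHat c ξ : ℂ) * g ξ := by
        rw [← integral_neg]
        congr 1 with ξ
        rw [phiHat_mul_eq hc hg0, integral_mul_const]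
        rcases eq_or_ne ξ 0 with rfl | hξ
        · simp [hg0]
        · rw [integral_complex_ofReal, (integral_mixture c hξ).2]

/-! ### The second difference of the multiquadric -/

/-- The function `(2 - 2 cos ξ) φ̂(ξ)`, extended continuously to `ξ = 0`: since
`2 - 2 cos ξ = ξ² sinc(ξ/2)²`, the factor `ξ⁻²` of `φ̂` cancels. -/
noncomputable def diffSymbol (c ξ : ℝ) : ℝ := -(2 * Real.sinc (ξ / 2) ^ 2 * profile c ξ)

theorem two_sub_two_cos (ξ : ℝ) : 2 - 2 * Real.cos ξ = ξ ^ 2 * Real.sinc (ξ / 2) ^ 2 := by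
  rcases eq_or_ne ξ 0 with rfl | hξ
  · simp
  · rw [Real.sinc_of_ne_zero (by positivity), div_pow, Real.sin_sq_eq_half_sub,
      mul_div_cancel₀ ξ two_ne_zero]
    field_simp

theorem diffSymbol_eq_phiHat {c ξ : ℝ} (hc : c ≠ 0) (hξ : ξ ≠ 0) :
    diffSymbol c ξ = (2 - 2 * Real.cos ξ) * phiHat c ξ := by
  rw [two_sub_two_cos, phiHat_eq hc hξ, diffSymbol]
  field_simp

theorem continuous_diffSymbol (c : ℝ) : Continuous (diffSymbol c) := by
  have := continuous_profile c
  have := Real.continuous_sinc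
  unfold diffSymbol
  fun_prop

theorem abs_diffSymbol_le (c ξ : ℝ) : |diffSymbol c ξ| ≤ 10 * (1 + ξ ^ 2)⁻¹ := by
  have h0 := profile_nonneg c ξ
  have h1 := profile_le_one c ξ
  have hs : Real.sinc (ξ / 2) ^ 2 ≤ 1 := (sq_le_one_iff_abs_le_one _).2 (Real.abs_sinc_le_one _)
  have hc : ξ ^ 2 * Real.sinc (ξ / 2) ^ 2 ≤ 4 := by
    rw [← two_sub_two_cos]
    linarith [Real.neg_one_le_cos ξ]
  have hs0 := sq_nonneg (Real.sinc (ξ / 2))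
  rw [diffSymbol, abs_neg, abs_of_nonneg (by positivity), ← div_eq_mul_inv,
    le_div_iff₀ (by positivity)]
  calc 2 * Real.sinc (ξ / 2) ^ 2 * profile c ξ * (1 + ξ ^ 2)
      = 2 * (Real.sinc (ξ / 2) ^ 2 + ξ ^ 2 * Real.sinc (ξ / 2) ^ 2) * profile c ξ := by ring
    _ ≤ 2 * (1 + 4) * 1 := by gcongr
    _ ≤ _ := by norm_num

theorem integrable_diffSymbol (c : ℝ) : Integrable (diffSymbol c) :=
  (integrable_inv_one_add_sq.const_mul 10).mono' (continuous_diffSymbol c).aestronglyMeasurable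
    (ae_of_all _ fun ξ => abs_diffSymbol_le c ξ)

/-- The negated second difference `2φ(x) - φ(x + 1) - φ(x - 1)` of the multiquadric. -/
noncomputable def phiDiff (c x : ℝ) : ℝ := 2 * phi c x - phi c (x + 1) - phi c (x - 1)

theorem phi_neg (c x : ℝ) : phi c (-x) = phi c x := by rw [phi, phi, neg_sq]

theorem phiDiff_neg (c x : ℝ) : phiDiff c (-x) = phiDiff c x := by
  have h1 : -x + 1 = -(x - 1) := by ring
  have h2 : -x - 1 = -(x + 1) := by ring
  rw [phiDiff, phiDiff, h1, h2, phi_neg, phi_neg, phi_neg]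
  ring

theorem phi_eq_norm (c x : ℝ) : phi c x = ‖(x + c * Complex.I : ℂ)‖ := by
  rw [Complex.norm_add_mul_I, phi]

/-- Convexity of `φ`, as the triangle inequality for `x ± 1 + ic`. -/
theorem phiDiff_nonpos (c x : ℝ) : phiDiff c x ≤ 0 := by
  have h := norm_add_le ((x + 1 : ℝ) + c * Complex.I : ℂ) ((x - 1 : ℝ) + c * Complex.I : ℂ)
  have e : ((x + 1 : ℝ) + c * Complex.I : ℂ) + ((x - 1 : ℝ) + c * Complex.I : ℂ) =
      2 * (x + c * Complex.I) := by push_cast; ring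
  rw [e, norm_mul, Complex.norm_ofNat, ← phi_eq_norm, ← phi_eq_norm, ← phi_eq_norm] at h
  rw [phiDiff]
  linarith

theorem abs_phi_add_one_sub_le (c x : ℝ) : |phi c (x + 1) - phi c x| ≤ 1 := by
  rw [phi_eq_norm, phi_eq_norm]
  refine (abs_norm_sub_norm_le _ _).trans ?_
  have : ((x + 1 : ℝ) + c * Complex.I : ℂ) - (x + c * Complex.I) = 1 := by push_cast; ring
  rw [this, norm_one]

/-- The values `phiDiff c n` are telescoping differences of one sign of the bounded sequence
`φ(n + 1) - φ(n)`. -/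
theorem summable_phiDiff (c : ℝ) : Summable fun m : ℤ => phiDiff c m := by
  have h1 : Summable fun n : ℕ => -phiDiff c ((n + 1 : ℕ) : ℝ) := by
    refine summable_of_sum_range_le (c := 2) (fun n => neg_nonneg.2 (phiDiff_nonpos c _)) fun N => ?_
    have : ∀ n : ℕ, -phiDiff c ((n + 1 : ℕ) : ℝ) =
        (phi c ((n + 1 : ℕ) + 1) - phi c (n + 1 : ℕ)) - (phi c (n + 1) - phi c n) := by
      intro n
      rw [phiDiff]
      push_cast
      rw [add_sub_cancel_right]
      ring
    rw [Finset.sum_congr rfl fun n _ => this n,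
      Finset.sum_range_sub (fun n : ℕ => phi c (n + 1) - phi c n)]
    have a := abs_le.1 (abs_phi_add_one_sub_le c N)
    have b := abs_le.1 (abs_phi_add_one_sub_le c (0 : ℕ))
    linarith [a.2, b.1]
  have h2 : Summable fun n : ℕ => phiDiff c n :=
    (summable_nat_add_iff (f := fun n : ℕ => phiDiff c n) 1).1 (by simpa using h1.neg)
  refine Summable.of_nat_of_neg (by simpa using h2) ?_
  simpa [phiDiff_neg] using h2

theorem integral_mixture_mul_exp (c y : ℝ) {v : ℝ} (hv : 0 < v) :
    Integrable (fun ξ : ℝ => (mixture c v ξ : ℂ) * Complex.exp (Complex.I * y * ξ)) ∧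
    ∫ ξ : ℝ, (mixture c v ξ : ℂ) * Complex.exp (Complex.I * y * ξ) =
      (2 * Real.sqrt Real.pi * (Real.exp (-(y ^ 2 + c ^ 2) * v ^ 2) / v ^ 2) : ℝ) := by
  have hb : 0 < 1 / (4 * v ^ 2) := by positivity
  have e : ∀ ξ : ℝ, mixture c v ξ =
      Real.exp (-(c ^ 2 * v ^ 2)) / v ^ 3 * Real.exp (-(1 / (4 * v ^ 2)) * ξ ^ 2) := by
    intro ξ
    have : -(1 / (4 * v ^ 2)) * ξ ^ 2 = -(ξ ^ 2 / (4 * v ^ 2)) := by ring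
    rw [mixture, this]
    ring
  have hi : Integrable (mixture c v) := by
    rw [funext e]
    exact (integrable_exp_neg_mul_sq hb).const_mul _
  constructor
  · refine hi.ofReal (𝕜 := ℂ) |>.mono ?_ (ae_of_all _ fun ξ => ?_)
    · unfold mixture
      exact Measurable.aestronglyMeasurable (by fun_prop)
    · have : ‖Complex.exp (Complex.I * y * ξ)‖ = 1 := by
        rw [Complex.norm_exp]; simp
      rw [norm_mul, this, mul_one]
      rfl
  · have h := integral_exp_mul_gaussian hb y
    have h1 : Real.sqrt (Real.pi / (1 / (4 * v ^ 2))) = Real.sqrt Real.pi * (2 * v) := by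
      have : Real.pi / (1 / (4 * v ^ 2)) = Real.pi * (2 * v) ^ 2 := by field_simp; ring
      rw [this, Real.sqrt_mul Real.pi_pos.le, Real.sqrt_sq (by positivity)]
    have h2 : -y ^ 2 / (4 * (1 / (4 * v ^ 2))) = -(y ^ 2 * v ^ 2) := by field_simp
    have h3 : -(y ^ 2 + c ^ 2) * v ^ 2 = -(y ^ 2 * v ^ 2) + -(c ^ 2 * v ^ 2) := by ring
    rw [h1, h2] at h
    calc _ = ∫ ξ : ℝ, ((Real.exp (-(c ^ 2 * v ^ 2)) / v ^ 3 : ℝ) : ℂ) *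
          (Complex.exp (Complex.I * y * ξ) * (Real.exp (-(1 / (4 * v ^ 2)) * ξ ^ 2) : ℂ)) := by
          congr 1 with ξ
          rw [e]
          push_cast
          ring
      _ = _ := by
          rw [integral_const_mul, h, h3, Real.exp_add, ← Complex.ofReal_mul]
          congr 1
          field_simp

/-- Fourier inversion for the second difference. In the Gaussian mixture for `phiDiff c x` the
constants cancel, and the factor `2 - 2 cos ξ` makes the double integral over `ξ` and `v` absolutely
convergent. -/
theorem phiDiff_eq_integral {c : ℝ} (hc : c ≠ 0) (x : ℝ) :
    (phiDiff c x : ℂ) =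
      (2 * Real.pi : ℂ)⁻¹ * ∫ ξ : ℝ, (diffSymbol c ξ : ℂ) * Complex.exp (Complex.I * x * ξ) := by
  have hpos : ∀ x : ℝ, 0 < x ^ 2 + c ^ 2 := fun x => by positivity
  set w : ℝ → ℝ → ℂ := fun ξ v =>
    (mixture c v ξ : ℂ) * ((2 * Real.cos ξ - 2 : ℝ) * Complex.exp (Complex.I * x * ξ)) with hw
  have hw_eq : ∀ ξ v, w ξ v = (mixture c v ξ : ℂ) * Complex.exp (Complex.I * (x + 1 : ℝ) * ξ) +
      (mixture c v ξ : ℂ) * Complex.exp (Complex.I * (x - 1 : ℝ) * ξ) -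
      2 * ((mixture c v ξ : ℂ) * Complex.exp (Complex.I * x * ξ)) := by
    intro ξ v
    have e1 : Complex.I * (x + 1 : ℝ) * ξ = Complex.I * x * ξ + ξ * Complex.I := by
      push_cast; ring
    have e2 : Complex.I * (x - 1 : ℝ) * ξ = Complex.I * x * ξ + -ξ * Complex.I := by
      push_cast; ring
    simp only [hw]
    rw [e1, e2, Complex.exp_add, Complex.exp_add]
    push_cast
    rw [Complex.cos]
    ring
  have hinner : ∀ v ∈ Ioi (0 : ℝ), ∫ ξ : ℝ, w ξ v = (2 * Real.sqrt Real.pi *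
      (2 * ((1 - Real.exp (-(x ^ 2 + c ^ 2) * v ^ 2)) / v ^ 2) -
        (1 - Real.exp (-((x + 1) ^ 2 + c ^ 2) * v ^ 2)) / v ^ 2 -
        (1 - Real.exp (-((x - 1) ^ 2 + c ^ 2) * v ^ 2)) / v ^ 2) : ℝ) := by
    intro v hv
    obtain ⟨i0, h0⟩ := integral_mixture_mul_exp c x hv
    obtain ⟨i1, h1⟩ := integral_mixture_mul_exp c (x + 1) hv
    obtain ⟨i2, h2⟩ := integral_mixture_mul_exp c (x - 1) hv
    simp only [hw_eq]
    rw [integral_sub (i1.fun_add i2) (i0.const_mul 2), integral_add i1 i2, integral_const_mul, h0, h1, h2]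
    push_cast
    ring
  have hnorm : ∀ ξ : ℝ, ‖((2 * Real.cos ξ - 2 : ℝ) * Complex.exp (Complex.I * x * ξ) : ℂ)‖ =
      2 - 2 * Real.cos ξ := by
    intro ξ
    have : ‖Complex.exp (Complex.I * x * ξ)‖ = 1 := by
      rw [Complex.norm_exp]; simp
    rw [norm_mul, this, mul_one, Complex.norm_real, Real.norm_of_nonpos
      (by linarith [Real.cos_le_one ξ])]
    ring
  have hne : ∀ᵐ ξ : ℝ, ξ ≠ 0 := compl_mem_ae_iff.2 (measure_singleton 0)
  have hswap : Integrable (Function.uncurry w) (volume.prod (volume.restrict (Ioi 0))) := by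
    refine (integrable_prod_iff (Measurable.aestronglyMeasurable
      (by simp only [hw, Function.uncurry_def, mixture]; fun_prop))).2 ⟨?_, ?_⟩
    · filter_upwards [hne] with ξ hξ
      exact (integral_mixture c hξ).1.ofReal (𝕜 := ℂ) |>.mul_const
        ((2 * Real.cos ξ - 2 : ℝ) * Complex.exp (Complex.I * x * ξ))
    · refine (integrable_diffSymbol c).norm.congr ?_
      filter_upwards [hne] with ξ hξ
      have : ∀ v ∈ Ioi (0 : ℝ), ‖Function.uncurry w (ξ, v)‖ =
          mixture c v ξ * (2 - 2 * Real.cos ξ) := by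
        intro v hv
        simp only [hw, Function.uncurry_apply_pair]
        rw [norm_mul, hnorm, Complex.norm_real, Real.norm_of_nonneg (mixture_nonneg hv)]
      rw [setIntegral_congr_fun measurableSet_Ioi this, integral_mul_const,
        (integral_mixture c hξ).2, diffSymbol_eq_phiHat hc hξ, phiHat_eq hc hξ, norm_mul, norm_neg,
        Real.norm_of_nonneg (by linarith [Real.cos_le_one ξ]),
        Real.norm_of_nonneg (mul_nonneg (by positivity) (profile_nonneg c ξ))]
      ring
  have hd := fun y => integrableOn_gaussian_defect (hpos y)
  have hsub : Integrable (fun v : ℝ => 2 * ((1 - Real.exp (-(x ^ 2 + c ^ 2) * v ^ 2)) / v ^ 2) -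
      (1 - Real.exp (-((x + 1) ^ 2 + c ^ 2) * v ^ 2)) / v ^ 2) (volume.restrict (Ioi 0)) :=
    Integrable.sub (Integrable.const_mul (hd x) 2) (hd (x + 1))
  have hleft : ∫ v in Ioi (0 : ℝ), ∫ ξ : ℝ, w ξ v = 2 * Real.pi * phiDiff c x := by
    rw [setIntegral_congr_fun measurableSet_Ioi hinner, integral_complex_ofReal,
      integral_const_mul, integral_sub hsub (hd (x - 1)),
      integral_sub ((hd x).const_mul 2) (hd (x + 1)), integral_const_mul,
      integral_gaussian_defect (hpos _), integral_gaussian_defect (hpos _),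
      integral_gaussian_defect (hpos _), phiDiff, phi, phi, phi]
    have hpi : (Real.sqrt Real.pi : ℂ) * Real.sqrt Real.pi = Real.pi := by
      exact_mod_cast Real.mul_self_sqrt Real.pi_pos.le
    push_cast
    rw [← hpi]
    ring
  have hright : ∫ v in Ioi (0 : ℝ), ∫ ξ : ℝ, w ξ v =
      ∫ ξ : ℝ, (diffSymbol c ξ : ℂ) * Complex.exp (Complex.I * x * ξ) := by
    rw [← integral_integral_swap hswap]
    refine integral_congr_ae ?_
    filter_upwards [hne] with ξ hξ
    simp only [hw]
    rw [integral_mul_const, integral_complex_ofReal, (integral_mixture c hξ).2,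
      diffSymbol_eq_phiHat hc hξ, phiHat_eq hc hξ]
    push_cast
    ring
  have hpi : (Real.pi : ℂ) ≠ 0 := by exact_mod_cast Real.pi_ne_zero
  rw [← hright, hleft]
  field_simp

/-! ### Poisson summation -/

theorem summable_phiHat {c : ℝ} (hc : c ≠ 0) {η : ℝ} (hη : ∀ k : ℤ, η + 2 * Real.pi * k ≠ 0) :
    Summable fun k : ℤ => phiHat c (η + 2 * Real.pi * k) := by
  have h := ((Real.summable_one_div_int_add_rpow (η / (2 * Real.pi)) 2).2 (by norm_num)).mul_left
    (2 / (2 * Real.pi) ^ 2)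
  refine h.of_norm_bounded fun k => ?_
  have hp := profile_le_one c (η + 2 * Real.pi * k)
  rw [phiHat_eq hc (hη k), norm_neg, Real.norm_of_nonneg
    (mul_nonneg (by positivity) (profile_nonneg c _))]
  have e : 2 / (2 * Real.pi) ^ 2 * (1 / |k + η / (2 * Real.pi)| ^ (2 : ℝ)) =
      2 / (η + 2 * Real.pi * k) ^ 2 := by
    have h1 : η + 2 * Real.pi * k = 2 * Real.pi * (k + η / (2 * Real.pi)) := by
      have := Real.pi_ne_zero
      field_simp
      ring
    rw [Real.rpow_two, sq_abs, h1, mul_pow (2 * Real.pi), div_mul_div_comm, mul_one]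
  rw [e]
  exact mul_le_of_le_one_right (by positivity) hp

theorem fourier_diffSymbol {c : ℝ} (hc : c ≠ 0) (y : ℝ) :
    𝓕 (fun t : ℝ => (diffSymbol c (2 * Real.pi * t) : ℂ)) y = phiDiff c y := by
  rw [Real.fourier_eq', ← phiDiff_neg, phiDiff_eq_integral hc]
  have h := Measure.integral_comp_mul_left
    (fun ξ : ℝ => (diffSymbol c ξ : ℂ) * Complex.exp (Complex.I * (-y : ℝ) * ξ)) (2 * Real.pi)
  rw [abs_of_pos (by positivity), Complex.real_smul] at h
  push_cast at h ⊢
  rw [← h]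
  congr 1 with t
  rw [smul_eq_mul, mul_comm]
  congr 2
  simp only [RCLike.inner_apply, conj_trivial]
  push_cast
  ring

/-- Poisson summation for `t ↦ (2 - 2 cos 2πt) φ̂(2πt)`, whose Fourier transform is the second
difference of `φ`; the factor `2 - 2 cos` is periodic and comes out of the sum over translates. -/
theorem hasSum_phiDiff_mul_exp {c : ℝ} (hc : c ≠ 0) {η : ℝ}
    (hη : ∀ k : ℤ, η + 2 * Real.pi * k ≠ 0) :
    HasSum (fun m : ℤ => (phiDiff c m : ℂ) * Complex.exp (Complex.I * η) ^ m)
      ((2 - 2 * Real.cos η : ℝ) * symbol c η) := by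
  have hpi := Real.pi_ne_zero
  have hsum : Summable fun m : ℤ => (phiDiff c m : ℂ) * Complex.exp (Complex.I * η) ^ m := by
    refine Summable.of_norm ((summable_phiDiff c).norm.congr fun m => ?_)
    have : ‖Complex.exp (Complex.I * η)‖ = 1 := by rw [Complex.norm_exp]; simp
    rw [norm_mul, norm_zpow, this, one_zpow, mul_one, Complex.norm_real]
  have hcont : Continuous fun t : ℝ => (diffSymbol c (2 * Real.pi * t) : ℂ) := by
    have := continuous_diffSymbol c
    fun_prop
  have hO : (fun t : ℝ => (diffSymbol c (2 * Real.pi * t) : ℂ)) =O[cocompact ℝ]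
      fun t : ℝ => |t| ^ (-2 : ℝ) := by
    refine Asymptotics.IsBigO.of_bound 10 ?_
    have : ({0}ᶜ : Set ℝ) ∈ cocompact ℝ := isCompact_singleton.compl_mem_cocompact
    filter_upwards [this] with t ht
    have ht : t ≠ 0 := ht
    rw [Complex.norm_real, Real.norm_eq_abs, Real.rpow_neg (abs_nonneg t), Real.rpow_two, sq_abs,
      Real.norm_of_nonneg (by positivity)]
    refine (abs_diffSymbol_le c _).trans ?_
    gcongr
    have h1 : 1 ≤ (2 * Real.pi) ^ 2 := one_le_pow₀ (by linarith [Real.pi_gt_three])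
    rw [mul_pow]
    linarith [le_mul_of_one_le_left (sq_nonneg t) h1]
  have hP := Real.tsum_eq_tsum_fourier_of_rpow_decay_of_summable hcont one_lt_two hO
    (by
      simp only [fourier_diffSymbol hc]
      exact Complex.summable_ofReal.2 (summable_phiDiff c)) (η / (2 * Real.pi))
  have hR : ∀ n : ℤ, 𝓕 (fun t : ℝ => (diffSymbol c (2 * Real.pi * t) : ℂ)) n *
      fourier n ((η / (2 * Real.pi) : ℝ) : UnitAddCircle) =
      (phiDiff c n : ℂ) * Complex.exp (Complex.I * η) ^ n := by
    intro n
    rw [fourier_diffSymbol hc, fourier_coe_apply, ← Complex.exp_int_mul]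
    congr 2
    push_cast
    have : (Real.pi : ℂ) ≠ 0 := by exact_mod_cast hpi
    field_simp
  have hL : ∀ n : ℤ, (diffSymbol c (2 * Real.pi * (η / (2 * Real.pi) + n)) : ℂ) =
      ((2 - 2 * Real.cos η : ℝ) : ℂ) * phiHat c (η + 2 * Real.pi * n) := by
    intro n
    have e : 2 * Real.pi * (η / (2 * Real.pi) + n) = η + 2 * Real.pi * n := by field_simp
    rw [e, diffSymbol_eq_phiHat hc (hη n), mul_comm (2 * Real.pi) (n : ℝ),
      Real.cos_add_int_mul_two_pi]
    push_cast
    rfl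
  rw [tsum_congr hL, tsum_congr hR, tsum_mul_left] at hP
  rw [symbol, Complex.ofReal_tsum, hP]
  exact hsum.hasSum

/-! ### Toeplitz forms on modulated differences -/

/-- Enlarging the square from `n` to `n + 1` adds the partial sum of `g` over `-n, …, n`, so the
claim is convergence of Cesàro means. -/
theorem tendsto_toeplitz_average {g : ℤ → ℂ} {L : ℂ} (hg : HasSum g L) :
    Tendsto (fun n : ℕ => (n : ℝ)⁻¹ • ∑ j ∈ Finset.range n, ∑ k ∈ Finset.range n, g (j - k))
      atTop (𝓝 L) := by
  have h1 : Summable fun n : ℕ => g n := hg.summable.comp_injective Nat.cast_injective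
  have h2 : Summable fun n : ℕ => g (-(n + 1)) :=
    hg.summable.comp_injective (i := fun n : ℕ => (-(n + 1) : ℤ)) fun a b h => by
      simpa using h
  have hu : Tendsto (fun n : ℕ => ∑ k ∈ Finset.range (n + 1), g k +
      ∑ k ∈ Finset.range n, g (-(k + 1))) atTop (𝓝 L) := by
    rw [← hg.tsum_eq, tsum_of_nat_of_neg_add_one h1 h2]
    exact ((tendsto_add_atTop_iff_nat 1).2 h1.hasSum.tendsto_sum_nat).add
      h2.hasSum.tendsto_sum_nat
  refine hu.cesaro_smul.congr fun n => ?_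
  congr 1
  induction n with
  | zero => simp
  | succ n ih =>
    rw [Finset.sum_range_succ, ih, Finset.sum_range_succ
      (fun j : ℕ => ∑ k ∈ Finset.range (n + 1), g ((j : ℤ) - (k : ℕ))) n]
    simp only [Finset.sum_range_succ _ n, Finset.sum_add_distrib]
    have e1 : ∑ k ∈ Finset.range n, g (-(k + 1)) = ∑ j ∈ Finset.range n, g (j - n) := by
      rw [← Finset.sum_range_reflect]
      refine Finset.sum_congr rfl fun j hj => congrArg g ?_
      have := Finset.mem_range.1 hj
      omega
    have e2 : ∑ k ∈ Finset.range n, g k + g n = ∑ k ∈ Finset.range n, g (n - k) + g (n - n) := by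
      have h := Finset.sum_flip (n := n) fun k : ℕ => g k
      rw [Finset.sum_range_succ, Finset.sum_range_succ] at h
      rw [← h]
      congr 1
      · refine Finset.sum_congr rfl fun j hj => congrArg g ?_
        have := Finset.mem_range.1 hj
        omega
      · simp
    rw [e1, e2]
    ring

/-- The sesquilinear form `∑_{j,k} y_j conj(z_k) κ(j - k)` of a kernel `κ` on `ℤ`. -/
noncomputable def kernelForm (κ : ℤ → ℂ) (y z : ℤ →₀ ℂ) : ℂ :=
  y.sum fun j a => z.sum fun k b => a * conj b * κ (j - k)

theorem kernelForm_sum_left {ι : Type*} (κ : ℤ → ℂ) (s : Finset ι) (y : ι → ℤ →₀ ℂ)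
    (z : ℤ →₀ ℂ) : kernelForm κ (∑ i ∈ s, y i) z = ∑ i ∈ s, kernelForm κ (y i) z := by
  unfold kernelForm
  rw [Finsupp.sum_finsetSum_index]
  · simp [Finsupp.sum]
  · simp [Finsupp.sum, add_mul, Finset.sum_add_distrib]

theorem kernelForm_sum_right {ι : Type*} (κ : ℤ → ℂ) (s : Finset ι) (y : ℤ →₀ ℂ)
    (z : ι → ℤ →₀ ℂ) : kernelForm κ y (∑ i ∈ s, z i) = ∑ i ∈ s, kernelForm κ y (z i) := by
  calc kernelForm κ y (∑ i ∈ s, z i)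
      = ∑ j ∈ y.support, ∑ i ∈ s, (z i).sum fun k b => y j * conj b * κ (j - k) := by
        refine Finset.sum_congr rfl fun j _ => ?_
        rw [Finsupp.sum_finsetSum_index (by simp) (by intro k a b; rw [map_add]; ring)]
    _ = _ := Finset.sum_comm

theorem kernelForm_single_sub_single (κ : ℤ → ℂ) (j k : ℤ) (a b : ℂ) :
    kernelForm κ (Finsupp.single j a - Finsupp.single (j + 1) a)
      (Finsupp.single k b - Finsupp.single (k + 1) b) =
      a * conj b * (2 * κ (j - k) - κ (j - k + 1) - κ (j - k - 1)) := by
  have h : ∀ (i : ℤ) (d : ℂ), ((Finsupp.single k b - Finsupp.single (k + 1) b).sum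
      fun k b => d * conj b * κ (i - k)) = d * conj b * (κ (i - k) - κ (i - (k + 1))) := by
    intro i d
    rw [Finsupp.sum_sub_index (by intro k x y; rw [map_sub]; ring), Finsupp.sum_single_index (by simp),
      Finsupp.sum_single_index (by simp)]
    ring
  have e1 : j + 1 - k = j - k + 1 := by ring
  have e2 : j + 1 - (k + 1) = j - k := by ring
  have e3 : j - (k + 1) = j - k - 1 := by ring
  unfold kernelForm
  rw [Finsupp.sum_sub_index (by intro i x y; rw [h, h, h]; ring), Finsupp.sum_single_index
    (by rw [h]; simp), Finsupp.sum_single_index (by rw [h]; simp), h, h, e1, e2, e3]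
  ring

/-- The backward difference of the truncated exponential `j ↦ ω^j`, `0 ≤ j < n`, that is
`∑_{j < n} ω^j (δ_j - δ_{j+1})`. Taking differences makes it zero-summing. -/
noncomputable def diffExp (ω : ℂ) (n : ℕ) : ℤ →₀ ℂ :=
  ∑ j ∈ Finset.range n, (Finsupp.single (j : ℤ) (ω ^ j) - Finsupp.single ((j : ℤ) + 1) (ω ^ j))

theorem diffExp_isZeroSumming (ω : ℂ) (n : ℕ) : IsZeroSumming (diffExp ω n) := by
  change (diffExp ω n).sum (fun _ a => a) = 0
  rw [diffExp, ← Finsupp.sum_finsetSum_index (by simp) (by simp)]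
  refine Finset.sum_eq_zero fun j _ => ?_
  rw [Finsupp.sum_sub_index (by simp), Finsupp.sum_single_index rfl, Finsupp.sum_single_index rfl,
    sub_self]

theorem diffExp_succ_ne_zero (ω : ℂ) (n : ℕ) : diffExp ω (n + 1) ≠ 0 := by
  intro h
  have h0 : diffExp ω (n + 1) 0 = 1 := by
    rw [diffExp, Finsupp.finsetSum_apply, Finset.sum_eq_single 0]
    · simp
    · intro j _ hj
      have h2 : (j : ℤ) + 1 ≠ 0 := by omega
      simp [hj, h2]
    · simp
  simp [h] at h0

/-- On modulated differences the form of `κ` is the Toeplitz form of the second difference of `κ`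
twisted by `ω`, so that its growth rate is the symbol of that second difference. -/
theorem tendsto_kernelForm_diffExp {κ : ℤ → ℂ} {ω L : ℂ} (hω : ‖ω‖ = 1)
    (h : HasSum (fun m : ℤ => (2 * κ m - κ (m + 1) - κ (m - 1)) * ω ^ m) L) :
    Tendsto (fun n : ℕ => (n : ℝ)⁻¹ • kernelForm κ (diffExp ω n) (diffExp ω n)) atTop (𝓝 L) := by
  refine (tendsto_toeplitz_average h).congr fun n => ?_
  congr 1
  have hω0 : ω ≠ 0 := norm_ne_zero_iff.1 (by simp [hω])
  simp only [diffExp, kernelForm_sum_left, kernelForm_sum_right, kernelForm_single_sub_single]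
  rw [Finset.sum_comm]
  refine Finset.sum_congr rfl fun k _ => Finset.sum_congr rfl fun j _ => ?_
  rw [zpow_sub₀ hω0, zpow_natCast, zpow_natCast, map_pow, ← Complex.inv_eq_conj hω, inv_pow]
  ring

theorem quadForm_eq_kernelForm (c : ℝ) (y : ℤ →₀ ℂ) :
    quadForm c y = kernelForm (fun m => (phi c m : ℂ)) y y := by
  simp [quadForm, kernelForm, Finsupp.sum]

theorem normSqSum_eq_kernelForm (y : ℤ →₀ ℂ) :
    (normSqSum y : ℂ) = kernelForm (Pi.single 0 1) y y := by
  rw [normSqSum, kernelForm, Finsupp.sum, Complex.ofReal_sum]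
  refine Finset.sum_congr rfl fun j hj => ?_
  rw [Finsupp.sum, Finset.sum_eq_single j]
  · rw [sub_self, Pi.single_eq_same, mul_one, Complex.mul_conj, Complex.normSq_eq_norm_sq]
  · intro k _ hk
    rw [Pi.single_eq_of_ne (sub_ne_zero.2 hk.symm), mul_zero]
  · exact fun h => absurd hj h

theorem hasSum_diff_single_mul_exp (η : ℝ) :
    HasSum (fun m : ℤ => (2 * (Pi.single 0 1 : ℤ → ℂ) m - (Pi.single 0 1 : ℤ → ℂ) (m + 1) -
      (Pi.single 0 1 : ℤ → ℂ) (m - 1)) * Complex.exp (Complex.I * η) ^ m)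
      (2 - 2 * Real.cos η : ℝ) := by
  set ω := Complex.exp (Complex.I * η) with hω
  have h0 := hasSum_pi_single (0 : ℤ) (2 : ℂ)
  have h1 := hasSum_pi_single (-1 : ℤ) (ω⁻¹ : ℂ)
  have h2 := hasSum_pi_single (1 : ℤ) (ω : ℂ)
  have hL : ((2 - 2 * Real.cos η : ℝ) : ℂ) = 2 - ω⁻¹ - ω := by
    rw [hω, ← Complex.exp_neg]
    push_cast
    rw [Complex.cos, mul_comm (η : ℂ), neg_mul, mul_comm (η : ℂ)]
    ring
  rw [hL]
  convert! (h0.sub h1).sub h2 using 2 with m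
  by_cases a : m = 0
  · subst a; simp
  by_cases b : m = 1
  · subst b; simp
  by_cases d : m = -1
  · subst d; simp
  have b' : m - 1 ≠ 0 := by omega
  have d' : m + 1 ≠ 0 := by omega
  simp [Pi.single_eq_of_ne, a, b, d, b', d']

end Multiquadric

theorem proposition3p4 (c : ℝ) (hc : c ≠ 0) :
    Multiquadric.IsGeneralizedFourierTransform (Multiquadric.phi c) (Multiquadric.phiHat c) ∧
    ∀ η ∈ Set.Ioo (0 : ℝ) (2 * Real.pi),
      Summable (fun k : ℤ => Multiquadric.phiHat c (η + 2 * Real.pi * k)) ∧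
      ∃ y : ℕ → (ℤ →₀ ℂ),
        (∀ n, Multiquadric.IsZeroSumming (y n) ∧ y n ≠ 0) ∧
        Filter.Tendsto
          (fun n => Multiquadric.quadForm c (y n) / (Multiquadric.normSqSum (y n) : ℂ))
          Filter.atTop (nhds (Multiquadric.symbol c η : ℂ)) := by
  refine ⟨Multiquadric.isGeneralizedFourierTransform_phiHat hc, fun η hη => ?_⟩
  obtain ⟨h0, h2⟩ := hη
  have hpi := Real.pi_pos
  have hne : ∀ k : ℤ, η + 2 * Real.pi * k ≠ 0 := by
    intro k h
    rcases le_or_gt 0 k with hk | hk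
    · have : (0 : ℝ) ≤ k := by exact_mod_cast hk
      linarith [mul_nonneg (mul_nonneg zero_le_two hpi.le) this]
    · have : (k : ℝ) ≤ -1 := by exact_mod_cast (by omega : k ≤ -1)
      linarith [mul_le_mul_of_nonneg_left this (mul_nonneg zero_le_two hpi.le)]
  have hcos : ((2 - 2 * Real.cos η : ℝ) : ℂ) ≠ 0 := by
    have : Real.cos η ≠ 1 := fun h =>
      h0.ne' ((Real.cos_eq_one_iff_of_lt_of_lt (by linarith) h2).1 h)
    exact Complex.ofReal_ne_zero.2 fun h => this (by linarith)
  refine ⟨Multiquadric.summable_phiHat hc hne,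
    fun n => Multiquadric.diffExp (Complex.exp (Complex.I * η)) (n + 1),
    fun n => ⟨Multiquadric.diffExp_isZeroSumming _ _, Multiquadric.diffExp_succ_ne_zero _ _⟩, ?_⟩
  have hω : ‖Complex.exp (Complex.I * η)‖ = 1 := by rw [Complex.norm_exp]; simp
  have hs := Multiquadric.hasSum_phiDiff_mul_exp hc hne
  have hterm : ∀ m : ℤ, (Multiquadric.phiDiff c m : ℂ) =
      2 * Multiquadric.phi c m - Multiquadric.phi c (m + 1 : ℤ) -
        Multiquadric.phi c (m - 1 : ℤ) := by
    intro m
    simp [Multiquadric.phiDiff]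
  simp only [hterm] at hs
  have hnum := Multiquadric.tendsto_kernelForm_diffExp (κ := fun m => (Multiquadric.phi c m : ℂ)) hω
    hs
  have hden := Multiquadric.tendsto_kernelForm_diffExp hω
    (Multiquadric.hasSum_diff_single_mul_exp η)
  have hlim := (tendsto_add_atTop_iff_nat 1).2 (hnum.div hden hcos)
  rw [mul_div_cancel_left₀ _ hcos] at hlim
  refine hlim.congr fun n => ?_
  rw [Multiquadric.quadForm_eq_kernelForm, Multiquadric.normSqSum_eq_kernelForm]
  simp only [Pi.div_apply, Complex.real_smul]
  exact mul_div_mul_left _ _ (Complex.ofReal_ne_zero.2 (by positivity))
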